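/- All graphs are finite, simple, undirected and (unless stated otherwise) unweighted. For a graph $G=(V,E)$ and a real $k\ge 0$, a weighted graph $H=(V,E',w)$ on the same vertex set, with nonnegative real edge weights, is a $+k$ additive emulator of $G$ if $$\mathrm{dist}_G(s,t)\;\le\;\mathrm{dist}_H(s,t)\;\le\;\mathrm{dist}_G(s,t)+k\qquad\text{for all } s,t\in V,$$ where distances are shortest-path distances, equal to $\infty$ between vertices in different components. For a real number $a$, let $\mathcal{E}(a)$ be the following assertion: there is a constant $C\ge 0$ such that for every $\epsilon>0$ there is a constant $K_\epsilon\ge 0$ such that, for every $n$, every $n$-vertex graph $G$ has a $+C n^{a+\epsilon}$ additive emulator with at most $K_\epsilon n$ edges. Let $\alpha\in(0,1)$. If $\mathcal{E}(\alpha)$ holds, then $\mathcal{E}\!\left(\frac{1}{6-4\alpha}\right)$ holds. In other words: if for every $\epsilon>0$ every $n$-vertex graph has an additive emulator with $O_\epsilon(n)$ edges and error $+O(n^{\alpha+\epsilon})$, then for every $\epsilon>0$ every $n$-vertex graph has an additive emulator with $O_\epsilon(n)$ edges and error $+O\!\left(n^{1/(6-4\alpha)+\epsilon}\right)$. -/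

import Mathlib

open scoped NNReal ENNReal

universe u

/-- An undirected weighted graph on the vertex set `V`: a simple graph together with a
nonnegative real weight for each edge (the values of `weight` off the edge set are irrelevant). -/
structure WeightedGraph (V : Type*) where
  graph : SimpleGraph V
  weight : Sym2 V → ℝ≥0

namespace WeightedGraph

variable {V : Type*}

/-- The length of a walk in a weighted graph: the sum of the weights of the edges it traverses,
counted with multiplicity. -/
def walkLength (H : WeightedGraph V) {s t : V} (p : H.graph.Walk s t) : ℝ≥0 :=
  (p.edges.map H.weight).sum

/-- The weighted shortest-path distance; it is `∞` when no walk joins `s` and `t`. -/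
noncomputable def dist (H : WeightedGraph V) (s t : V) : ℝ≥0∞ :=
  ⨅ p : H.graph.Walk s t, (H.walkLength p : ℝ≥0∞)

/-- The number of edges. -/
noncomputable def numEdges (H : WeightedGraph V) : ℕ :=
  H.graph.edgeSet.ncard

/-- `H` is a `+k` additive emulator of the unweighted graph `G`:
`dist_G(s,t) ≤ dist_H(s,t) ≤ dist_G(s,t) + k` for all vertices `s, t`, where distances between
vertices in different components are `∞`. -/
def IsAdditiveEmulator (H : WeightedGraph V) (G : SimpleGraph V) (k : ℝ≥0) : Prop :=
  ∀ s t : V, ((G.edist s t : ℕ∞) : ℝ≥0∞) ≤ H.dist s t ∧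
    H.dist s t ≤ ((G.edist s t : ℕ∞) : ℝ≥0∞) + (k : ℝ≥0∞)

end WeightedGraph

/-- For every `ε > 0`, every `n`-vertex graph has an additive emulator with `O_ε(n)` edges and
error `+O(n^(a + ε))`. The constant `C` in the error depends on neither the graph nor `ε`; the
constant `K` in the number of edges may depend on `ε`, but not on the graph. -/
def HasLinearSizeEmulators (a : ℝ) : Prop :=
  ∃ C : ℝ≥0, ∀ ε : ℝ, 0 < ε → ∃ K : ℝ≥0,
    ∀ (V : Type u) [Fintype V] (G : SimpleGraph V),
      ∃ H : WeightedGraph V,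
        (H.numEdges : ℝ≥0) ≤ K * (Fintype.card V : ℝ≥0) ∧
        H.IsAdditiveEmulator G (C * (Fintype.card V : ℝ≥0) ^ (a + ε))

/-! Put `R ≈ n^b` with `b` slightly above `1/(6-4α)`. Cover the graph by clusters of radius about
`R` whose cores are disjoint and whose enlargements have total size `O(n)` (`exists_cover`). Each
cluster gets a star. A light cluster, of size at most `R²`, has by averaging a boundary sphere of at
most `R` vertices (`exists_small_sphere`), so exact edges from the boundary vertices of all clusters
to the boundaries of their light home clusters cost `O(n)`. A heavy cluster gets the assumed
emulator, with error about `m^α` for size `m`.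

A geodesic then crosses light clusters without error, except at its two ends, and loses error only
in distinct heavy clusters (`ClusterSystem.exists_jumps`). Since `m > R²`, an error of `R` forces
these clusters to have total size about `R^(3-2α) ≥ √n` (`sum_lower_bound`).

So a pair `(s, t)` that is still badly joined has a prefix and a suffix of its geodesic each
touching a set of about `√n` vertices. One shortcut over the middle makes all pairs between the two
sets good, and none was good before, as otherwise `(s, t)` would be well joined. There are `n²`
pairs and each shortcut repairs about `n`, so `O(n)` shortcuts suffice (`exists_shortcuts`). -/

namespace SimpleGraph

/-! ### Bounded distance and chains of pairs -/

variable {V : Type*} {G : SimpleGraph V}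

/-- The vertices `u` and `v` are at distance at most `d`. -/
def Near (G : SimpleGraph V) (u v : V) (d : ℕ) : Prop :=
  ∃ p : G.Walk u v, p.length ≤ d

theorem Near.refl (u : V) (d : ℕ) : G.Near u u d :=
  ⟨.nil, by simp⟩

theorem Near.mono {u v : V} {a b : ℕ} (h : G.Near u v a) (hab : a ≤ b) : G.Near u v b :=
  let ⟨p, hp⟩ := h
  ⟨p, hp.trans hab⟩

theorem Near.symm {u v : V} {a : ℕ} (h : G.Near u v a) : G.Near v u a :=
  let ⟨p, hp⟩ := h
  ⟨p.reverse, by simpa using hp⟩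

theorem Near.trans {u v w : V} {a b : ℕ} (h : G.Near u v a) (h' : G.Near v w b) :
    G.Near u w (a + b) :=
  let ⟨p, hp⟩ := h
  let ⟨q, hq⟩ := h'
  ⟨p.append q, by rw [Walk.length_append]; omega⟩

theorem near_iff {u v : V} {d : ℕ} : G.Near u v d ↔ G.Reachable u v ∧ G.dist u v ≤ d := by
  constructor
  · rintro ⟨p, hp⟩
    exact ⟨⟨p⟩, (dist_le p).trans hp⟩
  · rintro ⟨h, hd⟩
    obtain ⟨p, hp⟩ := h.exists_walk_length_eq_dist
    exact ⟨p, hp.le.trans hd⟩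

theorem Reachable.near {u v : V} (h : G.Reachable u v) : G.Near u v (G.dist u v) :=
  near_iff.2 ⟨h, le_rfl⟩

theorem Near.dist_le {u v : V} {d : ℕ} (h : G.Near u v d) : G.dist u v ≤ d :=
  (near_iff.1 h).2

theorem Near.reachable {u v : V} {d : ℕ} (h : G.Near u v d) : G.Reachable u v :=
  (near_iff.1 h).1

/-- The pairs in `F`, each used as an edge of length the distance of its ends in `G`,
join `u` and `v` by a chain of total length at most `d`. -/
inductive Conn (G : SimpleGraph V) (F : Finset (V × V)) : V → V → ℕ → Prop
  | refl (u : V) (d : ℕ) : Conn G F u u d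
  | step {u v w : V} {a b : ℕ} : ((u, v) ∈ F ∨ (v, u) ∈ F) → G.Near u v a → Conn G F v w b →
      Conn G F u w (a + b)

namespace Conn

variable {F F' : Finset (V × V)} {u v w : V} {a b : ℕ}

theorem mono (h : G.Conn F u v a) (hab : a ≤ b) : G.Conn F u v b := by
  induction h generalizing b with
  | refl u d => exact .refl u b
  | @step u v w a d h₁ h₂ _ ih =>
    have := Conn.step h₁ h₂ (ih (b := b - a) (by omega))
    rwa [Nat.add_sub_cancel' (by omega)] at this

theorem subset (h : G.Conn F u v a) (hF : F ⊆ F') : G.Conn F' u v a := by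
  induction h with
  | refl u d => exact .refl u d
  | step h₁ h₂ _ ih => exact .step (h₁.imp (@hF _) (@hF _)) h₂ ih

theorem trans (h : G.Conn F u v a) (h' : G.Conn F v w b) : G.Conn F u w (a + b) := by
  induction h with
  | refl u d => exact h'.mono (by omega)
  | step h₁ h₂ _ ih =>
    rw [add_assoc]
    exact .step h₁ h₂ (ih h')

theorem edge (h : (u, v) ∈ F) (hn : G.Near u v a) : G.Conn F u v a :=
  .step (.inl h) hn (.refl v 0)

theorem symm (h : G.Conn F u v a) : G.Conn F v u a := by
  induction h with
  | refl u d => exact .refl u d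
  | step h₁ h₂ _ ih =>
    rw [add_comm]
    exact ih.trans (.step h₁.symm h₂.symm (.refl _ 0))

theorem near (h : G.Conn F u v a) : G.Near u v a := by
  induction h with
  | refl u d => exact .refl u d
  | step _ h₂ _ ih => exact h₂.trans ih

theorem map {W : Type*} {G' : SimpleGraph W} (f : G →g G') [DecidableEq W]
    (h : G.Conn F u v a) :
    G'.Conn (F.image (Prod.map f f)) (f u) (f v) a := by
  induction h with
  | refl u d => exact .refl _ d
  | @step u v w a b h₁ h₂ _ ih =>
    obtain ⟨p, hp⟩ := h₂
    refine .step (a := a) ?_ ⟨p.map f, by simpa using hp⟩ ih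
    exact h₁.imp (fun h => Finset.mem_image_of_mem (Prod.map f f) h)
      (fun h => Finset.mem_image_of_mem (Prod.map f f) h)

end Conn

end SimpleGraph

/-! ### Passing between emulators and finite sets of pairs -/

namespace WeightedGraph

open SimpleGraph

variable {V : Type*} {G : SimpleGraph V}

theorem walkLength_cons (H : WeightedGraph V) {u v w : V} (h : H.graph.Adj u v)
    (p : H.graph.Walk v w) :
    H.walkLength (Walk.cons h p) = H.weight s(u, v) + H.walkLength p := by
  simp [walkLength]

/-- The lower emulator bound on a single edge says that its weight is at least the distance of its
ends, so lowering weights to distances only shortens walks. Lengths become integers, which is why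
the error can be rounded down. -/
theorem exists_pairs_of_isAdditiveEmulator [Finite V] {H : WeightedGraph V} {k : ℝ≥0}
    (hH : H.IsAdditiveEmulator G k) :
    ∃ F : Finset (V × V), F.card ≤ H.numEdges ∧
      ∀ s t, G.Reachable s t → G.Conn F s t (G.dist s t + ⌊k⌋₊) := by
  classical
  have hfin : H.graph.edgeSet.Finite := Set.toFinite _
  have hedge : ∀ u v, H.graph.Adj u v →
      G.Reachable u v ∧ (G.dist u v : ℝ≥0) ≤ H.weight s(u, v) := by
    intro u v huv
    have h₁ : H.dist u v ≤ (H.weight s(u, v) : ℝ≥0∞) := by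
      refine (iInf_le _ (Walk.cons huv Walk.nil)).trans ?_
      simp [walkLength]
    have h₂ := (hH u v).1.trans h₁
    have hr : G.Reachable u v := by
      rw [← edist_ne_top_iff_reachable]
      intro h
      simp [h] at h₂
    refine ⟨hr, ?_⟩
    rwa [← hr.coe_dist_eq_edist, ENat.toENNReal_coe, ← ENNReal.coe_natCast,
      ENNReal.coe_le_coe] at h₂
  let F : Finset (V × V) := hfin.toFinset.image Quot.out
  have hF : ∀ u v, H.graph.Adj u v → (u, v) ∈ F ∨ (v, u) ∈ F := by
    intro u v huv
    have hm : Quot.out s(u, v) ∈ F :=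
      Finset.mem_image_of_mem _ (by simpa using huv)
    have he : s((Quot.out s(u, v)).1, (Quot.out s(u, v)).2) = s(u, v) := Quot.out_eq s(u, v)
    rcases Sym2.eq_iff.1 he with h | h
    · exact .inl (by rwa [show (u, v) = Quot.out s(u, v) from Prod.ext h.1.symm h.2.symm])
    · exact .inr (by rwa [show (v, u) = Quot.out s(u, v) from Prod.ext h.1.symm h.2.symm])
  have hwalk : ∀ {s t : V} (p : H.graph.Walk s t),
      ∃ d : ℕ, (d : ℝ≥0) ≤ H.walkLength p ∧ G.Conn F s t d := by
    intro s t p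
    induction p with
    | nil => exact ⟨0, by simp, .refl _ _⟩
    | @cons u v w h p ih =>
      obtain ⟨d, hd, hc⟩ := ih
      refine ⟨G.dist u v + d, ?_, .step (hF _ _ h) (hedge _ _ h).1.near hc⟩
      rw [walkLength_cons]
      push_cast
      exact add_le_add (hedge _ _ h).2 hd
  refine ⟨F, ?_, ?_⟩
  · refine Finset.card_image_le.trans ?_
    rw [numEdges, Set.ncard_eq_toFinset_card _ hfin]
  · intro s t hst
    have h₁ := (hH s t).2
    rw [← hst.coe_dist_eq_edist, ENat.toENNReal_coe, ← ENNReal.coe_natCast,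
      ← ENNReal.coe_add] at h₁
    have h₂ : H.dist s t < ((G.dist s t + ⌊k⌋₊ + 1 : ℕ) : ℝ≥0∞) := by
      refine h₁.trans_lt ?_
      have : (G.dist s t : ℝ≥0) + k < ((G.dist s t + ⌊k⌋₊ + 1 : ℕ) : ℝ≥0) := by
        push_cast
        rw [add_assoc]
        exact add_lt_add_right (Nat.lt_floor_add_one k) _
      rwa [← ENNReal.coe_natCast, ENNReal.coe_lt_coe]
    obtain ⟨p, hp⟩ := iInf_lt_iff.1 h₂
    obtain ⟨d, hd, hc⟩ := hwalk p
    refine hc.mono ?_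
    have h₃ : (d : ℝ≥0) < ((G.dist s t + ⌊k⌋₊ + 1 : ℕ) : ℝ≥0) :=
      hd.trans_lt (by rwa [← ENNReal.coe_natCast, ENNReal.coe_lt_coe] at hp)
    have h₄ : d < G.dist s t + ⌊k⌋₊ + 1 := by exact_mod_cast h₃
    omega

/-- The weighted graph whose edges are the pairs in `F` that are joined in `G`,
weighted by the distance in `G`. -/
noncomputable def ofPairs (G : SimpleGraph V) (F : Finset (V × V)) : WeightedGraph V where
  graph := .fromRel fun u v => (u, v) ∈ F ∧ G.Reachable u v
  weight := Sym2.lift ⟨fun u v => (G.dist u v : ℝ≥0), fun u v => by simp only [G.dist_comm]⟩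

theorem numEdges_ofPairs_le (F : Finset (V × V)) : (ofPairs G F).numEdges ≤ F.card := by
  classical
  have h : (ofPairs G F).graph.edgeSet ⊆ (F.image fun p => s(p.1, p.2) : Finset (Sym2 V)) := by
    intro e he
    induction e using Sym2.ind with
    | _ u v =>
      rw [mem_edgeSet, ofPairs, fromRel_adj] at he
      simp only [Finset.coe_image, Set.mem_image, Finset.mem_coe]
      rcases he.2 with h | h
      · exact ⟨_, h.1, rfl⟩
      · exact ⟨_, h.1, Sym2.eq_swap⟩
  refine (Set.ncard_le_ncard h (Finset.finite_toSet _)).trans ?_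
  rw [Set.ncard_coe_finset]
  exact Finset.card_image_le

theorem isAdditiveEmulator_ofPairs {F : Finset (V × V)} {k : ℕ} {k' : ℝ≥0} (hk : (k : ℝ≥0) ≤ k')
    (hF : ∀ s t, G.Reachable s t → G.Conn F s t (G.dist s t + k)) :
    (ofPairs G F).IsAdditiveEmulator G k' := by
  intro s t
  constructor
  · refine le_iInf fun p => ?_
    have h : G.Reachable s t ∧ (G.dist s t : ℝ≥0) ≤ (ofPairs G F).walkLength p := by
      induction p with
      | nil => simp
      | @cons u v w h p ih =>
        have hr : G.Reachable u v := by
          rw [ofPairs, fromRel_adj] at h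
          exact h.2.elim (fun h => h.2) (fun h => h.2.symm)
        refine ⟨hr.trans ih.1, ?_⟩
        have : (ofPairs G F).walkLength (Walk.cons h p)
            = G.dist u v + (ofPairs G F).walkLength p := by
          exact walkLength_cons _ h p
        rw [this]
        refine le_trans ?_ (add_le_add_right ih.2 _)
        exact_mod_cast hr.dist_triangle_left w
    rw [← h.1.coe_dist_eq_edist, ENat.toENNReal_coe, ← ENNReal.coe_natCast, ENNReal.coe_le_coe]
    exact h.2
  · by_cases hst : G.Reachable s t
    · have key : ∀ {u v : V} {d : ℕ}, G.Conn F u v d → (ofPairs G F).dist u v ≤ d := by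
        intro u v d h
        induction h with
        | refl u d =>
          refine (iInf_le _ Walk.nil).trans ?_
          simp [walkLength]
        | @step u v w a b h₁ h₂ _ ih =>
          by_cases huv : u = v
          · subst huv
            refine ih.trans ?_
            exact_mod_cast Nat.le_add_left b a
          · have hadj : (ofPairs G F).graph.Adj u v := by
              rw [ofPairs, fromRel_adj]
              exact ⟨huv, h₁.imp (fun h => ⟨h, h₂.reachable⟩) (fun h => ⟨h, h₂.reachable.symm⟩)⟩
            have h₃ : (ofPairs G F).dist u w ≤ a + (ofPairs G F).dist v w := by
              conv_rhs => rw [dist, ENNReal.add_iInf]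
              refine le_iInf fun p => (iInf_le _ (Walk.cons hadj p)).trans ?_
              have h₄ : (ofPairs G F).walkLength (Walk.cons hadj p)
                  = G.dist u v + (ofPairs G F).walkLength p := by
                exact walkLength_cons _ hadj p
              rw [h₄]
              push_cast
              exact add_le_add_left (by exact_mod_cast h₂.dist_le) _
            refine h₃.trans ?_
            push_cast
            exact add_le_add_right ih _
      refine (key (hF s t hst)).trans ?_
      rw [← hst.coe_dist_eq_edist]
      push_cast
      exact add_le_add_right (by exact_mod_cast hk) _
    · rw [edist_eq_top_of_not_reachable hst]
      simp

end WeightedGraph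

/-! ### Shortcuts by a potential argument -/

namespace SimpleGraph

variable {V : Type*} {G : SimpleGraph V}

/-- If every pair of vertices that `F₀` joins badly admits a single shortcut `(u, w)` along a
geodesic which improves the connection of all pairs of two sets of size at least `W`, then adding
`|V|² / W²` shortcuts to `F₀` suffices to join every pair well. -/
theorem exists_shortcuts [Fintype V] (F₀ : Finset (V × V)) (Q W : ℕ)
    (h : ∀ s t L, G.Near s t L → (∀ d, G.Near s t d → L ≤ d) →
      G.Conn F₀ s t (L + 24 * Q) ∨
      ∃ (u w : V) (X Y : Finset V) (d : ℕ), G.Near u w d ∧ W ≤ X.card ∧ W ≤ Y.card ∧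
        ∀ x ∈ X, ∀ y ∈ Y, ∃ (z z' : V) (a b b' a' : ℕ), a + b + d + b' + a' = L ∧
          G.Near s z a ∧ G.Near z u b ∧ G.Near w z' b' ∧ G.Near z' t a' ∧
          G.Conn F₀ s z (a + 4 * Q) ∧ G.Conn F₀ z u (b + 4 * Q) ∧ G.Conn F₀ z x Q ∧
          G.Conn F₀ w z' (b' + 4 * Q) ∧ G.Conn F₀ z' t (a' + 4 * Q) ∧ G.Conn F₀ z' y Q) :
    ∃ F : Finset (V × V), F.card * W ^ 2 ≤ F₀.card * W ^ 2 + Fintype.card V ^ 2 ∧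
      ∀ s t, G.Reachable s t → G.Conn F s t (G.dist s t + 24 * Q) := by
  classical
  rcases Nat.eq_zero_or_pos W with rfl | hW
  · refine ⟨Finset.univ, by simp, fun s t hst => ?_⟩
    exact (Conn.edge (Finset.mem_univ _) hst.near).mono (by omega)
  -- The potential counts pairs joined with error `12 * Q`. This is stricter than the final `24 *
  -- Q`, to leave room for detours from the geodesic to `x` and `y`. A set of maximal size among
  -- those paid for by the potential is taken.
  let good : Finset (V × V) → Finset (V × V) := fun F =>
    Finset.univ.filter fun p => ∀ d, G.Near p.1 p.2 d → G.Conn F p.1 p.2 (d + 12 * Q)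
  let S : Finset (Finset (V × V)) := Finset.univ.filter fun F =>
    F₀ ⊆ F ∧ F.card * W ^ 2 ≤ F₀.card * W ^ 2 + (good F).card
  have hS : F₀ ∈ S := by simp [S]
  obtain ⟨F, hFS, hmax⟩ := S.exists_max_image Finset.card ⟨F₀, hS⟩
  simp only [S, Finset.mem_filter, Finset.mem_univ, true_and] at hFS hmax
  obtain ⟨hF, hcard⟩ := hFS
  refine ⟨F, hcard.trans ?_, ?_⟩
  · have := Finset.card_le_univ (good F)
    rw [Fintype.card_prod, ← sq] at this
    omega
  intro s t hst
  by_contra hbad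
  obtain h₁ | ⟨u, w, X, Y, d, huw, hX, hY, hXY⟩ :=
    h s t _ hst.near fun d hd => hd.dist_le
  · exact hbad (h₁.subset hF)
  have hins : F ⊆ insert (u, w) F := Finset.subset_insert _ _
  -- The new chain exceeds `b + d + b'` by `10 * Q`. Minimality of `L` bounds `b + d + b'` by `dist
  -- x y + 2 * Q`.
  have hnew : X ×ˢ Y ⊆ good (insert (u, w) F) := by
    rintro ⟨x, y⟩ hxy
    obtain ⟨hx, hy⟩ := Finset.mem_product.1 hxy
    obtain ⟨z, z', a, b, b', a', hL, sz, zu, wz, zt, csz, czu, czx, cwz, czt, czy⟩ := hXY x hx y hy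
    simp only [good, Finset.mem_filter, Finset.mem_univ, true_and]
    intro e he
    have h₁ := (((sz.trans czx.near).trans he).trans (czy.near.symm.trans zt)).dist_le
    have h₂ : G.Conn (insert (u, w) F) u w d := .edge (Finset.mem_insert_self _ _) huw
    have h₃ := ((((czx.symm.trans czu).subset (hF.trans hins)).trans h₂).trans
      ((cwz.trans czy).subset (hF.trans hins)))
    exact h₃.mono (by omega)
  -- A good pair `(x, y)` would join `s` to `t` with error `5 + 2 + 12 + 5 = 24` times `Q`.
  have hold : Disjoint (X ×ˢ Y) (good F) := by
    rw [Finset.disjoint_left]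
    rintro ⟨x, y⟩ hxy hg
    obtain ⟨hx, hy⟩ := Finset.mem_product.1 hxy
    obtain ⟨z, z', a, b, b', a', hL, sz, zu, wz, zt, csz, czu, czx, cwz, czt, czy⟩ := hXY x hx y hy
    simp only [good, Finset.mem_filter, Finset.mem_univ, true_and] at hg
    have h₁ := hg _ (((czx.near.symm.trans zu).trans huw).trans (wz.trans czy.near))
    apply hbad
    have h₂ := ((csz.trans czx).subset hF).trans (h₁.trans ((czy.symm.trans czt).subset hF))
    exact h₂.mono (by omega)
  have hmono : good F ⊆ good (insert (u, w) F) := by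
    intro p hp
    simp only [good, Finset.mem_filter, Finset.mem_univ, true_and] at hp ⊢
    exact fun d hd => (hp d hd).subset hins
  have hgood : W ^ 2 + (good F).card ≤ (good (insert (u, w) F)).card := by
    have h₁ := Finset.card_le_card (Finset.union_subset hnew hmono)
    rw [Finset.card_union_of_disjoint hold, Finset.card_product] at h₁
    have h₂ : W ^ 2 ≤ X.card * Y.card := by
      rw [sq]
      exact Nat.mul_le_mul hX hY
    omega
  have hnot : (u, w) ∉ F := by
    intro hmem
    rw [Finset.insert_eq_of_mem hmem] at hgood
    have : 0 < W ^ 2 := by positivity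
    omega
  have hc := Finset.card_insert_of_notMem hnot
  have := hmax (insert (u, w) F) ⟨hF.trans hins, by rw [hc, add_mul]; omega⟩
  omega

/-! ### Cluster systems and jumps along a geodesic -/

theorem Walk.near_getVert {s t : V} (p : G.Walk s t) {i j : ℕ} (hij : i ≤ j) :
    G.Near (p.getVert i) (p.getVert j) (j - i) := by
  induction j, hij using Nat.le_induction with
  | base => exact .refl _ _
  | succ j hij ih =>
    have h₁ : G.Near (p.getVert j) (p.getVert (j + 1)) 1 := by
      by_cases hj : j < p.length
      · exact ⟨(p.adj_getVert_succ hj).toWalk, by simp⟩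
      · rw [p.getVert_of_length_le (by omega), p.getVert_of_length_le (by omega)]
        exact .refl _ _
    exact (ih.trans h₁).mono (by omega)

/-- The vertices at distance at most `r` from `c`. -/
noncomputable def nearSet [Fintype V] (G : SimpleGraph V) (c : V) (r : ℕ) : Finset V :=
  open Classical in Finset.univ.filter fun v => G.Near c v r

theorem mem_nearSet [Fintype V] {c v : V} {r : ℕ} : v ∈ G.nearSet c r ↔ G.Near c v r := by
  simp [nearSet]

/-- A home cluster `home u` for every vertex `u`, with a core radius `r`, an outer radius `ρ`, and
a set `F` of pairs that contains stars inside the clusters, all pairs from the boundary of any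
cluster to the boundary of the light home cluster it meets, and an emulator with error `f c`
inside each heavy cluster `c`. -/
structure ClusterSystem (G : SimpleGraph V) (F : Finset (V × V)) (Q : ℕ) where
  home : V → V
  r : V → ℕ
  ρ : V → ℕ
  f : V → ℕ
  light : V → Prop
  near_home : ∀ u, G.Near (home u) u (3 * r (home u))
  lt_ρ : ∀ u, 3 * r (home u) < ρ (home u)
  ρ_le : ∀ u, ρ (home u) ≤ 4 * r (home u)
  le_Q : ∀ u, 7 * r (home u) ≤ Q
  star : ∀ u x, G.Near (home u) x (4 * r (home u)) → (home u, x) ∈ F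
  cross : ∀ v u w, light (home u) → G.Near (home v) u (ρ (home v)) →
    ¬ G.Near (home v) u (ρ (home v) - 1) → G.Near (home u) w (ρ (home u)) →
    ¬ G.Near (home u) w (ρ (home u) - 1) → (u, w) ∈ F
  emulate : ∀ u w d, ¬ light (home u) → G.Near (home u) w (4 * r (home u)) → G.Near u w d →
    G.Conn F u w (d + f (home u))

/-- A geodesic is traversed by jumps between pairwise distinct home clusters; jumps through light
clusters are exact, except possibly for the first and the last one. -/
theorem ClusterSystem.exists_jumps {F : Finset (V × V)} {Q : ℕ} (S : ClusterSystem G F Q)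
    {s t : V} (p : G.Walk s t) :
    ∃ (k : ℕ) (X e : ℕ → ℕ), X 0 = 0 ∧ X k = p.length ∧ (∀ i < k, X i ≤ X (i + 1)) ∧
      (∀ i < k, G.Conn F (p.getVert (X i)) (p.getVert (X (i + 1))) (X (i + 1) - X i + e i)) ∧
      (∀ i < k, e i ≤ Q) ∧
      (∀ i < k, S.light (S.home (p.getVert (X i))) → e i ≠ 0 → i = 0 ∨ i + 1 = k) ∧
      (∀ i < k, ¬ S.light (S.home (p.getVert (X i))) → e i ≤ S.f (S.home (p.getVert (X i)))) ∧
      (∀ j < k, ∀ i < j, S.home (p.getVert (X i)) ≠ S.home (p.getVert (X j))) := by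
  classical
  set γ := p.getVert with hγ
  set L := p.length
  -- Greedy jump: the last index on the walk that lies in the outer ball of the current home
  -- cluster.
  let nxt : ℕ → ℕ := fun x =>
    Nat.findGreatest (fun y => G.Near (S.home (γ x)) (γ y) (S.ρ (S.home (γ x)))) L
  have hself : ∀ x, G.Near (S.home (γ x)) (γ x) (S.ρ (S.home (γ x))) := fun x =>
    (S.near_home (γ x)).mono (S.lt_ρ (γ x)).le
  have hnear : ∀ x ≤ L, G.Near (S.home (γ x)) (γ (nxt x)) (S.ρ (S.home (γ x))) := fun x hx =>
    Nat.findGreatest_spec (P := fun y => G.Near (S.home (γ x)) (γ y) (S.ρ (S.home (γ x))))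
      hx (hself x)
  have hstep : ∀ y, G.Near (γ y) (γ (y + 1)) 1 := fun y => by
    simpa using p.near_getVert (Nat.le_succ y)
  have hle : ∀ x, nxt x ≤ L := fun x => Nat.findGreatest_le L
  have hlt : ∀ x < L, x < nxt x := fun x hx => by
    refine Nat.lt_of_succ_le (Nat.le_findGreatest hx ?_)
    exact ((S.near_home (γ x)).trans (hstep x)).mono (S.lt_ρ (γ x))
  -- If `γ (nxt x)` were inside radius `ρ - 1`, its successor would be within `ρ`, against
  -- maximality. So a jump that stops before the end lands exactly on the boundary sphere.
  have hout : ∀ x y, nxt x < L → nxt x ≤ y → y ≤ L →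
      ¬ G.Near (S.home (γ x)) (γ y) (S.ρ (S.home (γ x)) - 1) := by
    intro x y hxL hxy hy hn
    have hρ := S.lt_ρ (γ x)
    rcases hxy.eq_or_lt with rfl | hxy
    · exact Nat.findGreatest_is_greatest (lt_add_one _) hxL
        ((hn.trans (hstep _)).mono (by omega))
    · exact Nat.findGreatest_is_greatest hxy hy (hn.mono (by omega))
  let X : ℕ → ℕ := fun i => nxt^[i] 0
  have hX : ∀ i, X (i + 1) = nxt (X i) := fun i => Function.iterate_succ_apply' nxt i 0
  have hXle : ∀ i, X i ≤ L := by
    intro i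
    cases i with
    | zero => exact Nat.zero_le _
    | succ i => rw [hX]; exact hle _
  have hreach : ∃ k, X k = L := by
    have : ∀ i, min i L ≤ X i := by
      intro i
      induction i with
      | zero => simp
      | succ i ih =>
        rw [hX]
        rcases (hXle i).eq_or_lt with h | h
        · have : L ≤ nxt (X i) := by
            rw [h]
            exact Nat.le_findGreatest le_rfl (hself L)
          omega
        · have := hlt _ h
          omega
    exact ⟨L, le_antisymm (hXle L) (by simpa using this L)⟩
  let k := Nat.find hreach
  have hXlt : ∀ i < k, X i < L := fun i hi =>
    lt_of_le_of_ne (hXle i) (Nat.find_min hreach hi)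
  have hinc : ∀ i < k, X i < X (i + 1) := fun i hi => by
    rw [hX]
    exact hlt _ (hXlt i hi)
  have hmono : ∀ j ≤ k, ∀ i ≤ j, X i ≤ X j := by
    intro j hj i hij
    induction j, hij using Nat.le_induction with
    | base => exact le_rfl
    | succ j hij ih => exact (ih (by omega)).trans (hinc j (by omega)).le
  have herr : ∀ i, ∃ e : ℕ, i < k →
      G.Conn F (γ (X i)) (γ (X (i + 1))) (X (i + 1) - X i + e) ∧ e ≤ Q ∧
      (S.light (S.home (γ (X i))) → e ≠ 0 → i = 0 ∨ i + 1 = k) ∧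
      (¬ S.light (S.home (γ (X i))) → e ≤ S.f (S.home (γ (X i)))) := by
    intro i
    by_cases hi : i < k
    swap
    · exact ⟨0, fun h => absurd h hi⟩
    have hN := hnear _ (hXle i)
    rw [← hX] at hN
    have hN' := hN.mono (S.ρ_le _)
    have hd := p.near_getVert (hinc i hi).le
    have hstar : G.Conn F (γ (X i)) (γ (X (i + 1))) (X (i + 1) - X i + Q) := by
      have h₁ := S.near_home (γ (X i))
      have h₂ := (Conn.edge (S.star _ _ (h₁.mono (by omega))) h₁).symm.trans
        (.edge (S.star _ _ hN') hN')
      have := S.le_Q (γ (X i))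
      exact h₂.mono (by omega)
    by_cases hl : S.light (S.home (γ (X i)))
    · by_cases hend : i = 0 ∨ i + 1 = k
      · exact ⟨Q, fun _ => ⟨hstar, le_rfl, fun _ _ => hend, fun h => absurd hl h⟩⟩
      · refine ⟨0, fun _ => ⟨.edge ?_ hd, Nat.zero_le _, fun _ h => absurd rfl h,
          fun _ => Nat.zero_le _⟩⟩
        -- An inner jump starts on the boundary of the previous cluster and lands on that of its
        -- own, so `cross` supplies the exact edge.
        push Not at hend
        obtain ⟨j, rfl⟩ := Nat.exists_eq_succ_of_ne_zero hend.1
        have h₁ := hnear _ (hXle j)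
        have h₂ := hXlt (j + 1) hi
        have h₃ := hXlt (j + 1 + 1) (by omega)
        have h₄ := hout (X j) (X (j + 1)) (by rwa [← hX]) (hX _).ge h₂.le
        have h₅ := hout (X (j + 1)) (X (j + 1 + 1)) (by rwa [← hX]) (hX _).ge h₃.le
        rw [← hX] at h₁
        exact S.cross _ _ _ hl h₁ h₄ hN h₅
    -- The minimum with the star error keeps each single error at most `Q`, so partial sums of
    -- errors grow in steps of at most `Q`.
    · refine ⟨min Q (S.f (S.home (γ (X i)))), fun _ => ⟨?_, min_le_left _ _,
        fun h => absurd h hl, fun _ => min_le_right _ _⟩⟩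
      rcases min_choice Q (S.f (S.home (γ (X i)))) with h | h <;> rw [h]
      · exact hstar
      · exact S.emulate _ _ _ hl hN' hd
  choose e he using herr
  refine ⟨k, X, e, rfl, Nat.find_spec hreach, fun i hi => (hinc i hi).le,
    fun i hi => (he i hi).1, fun i hi => (he i hi).2.1, fun i hi => (he i hi).2.2.1,
    fun i hi => (he i hi).2.2.2, ?_⟩
  intro j hj i hij heq
  have h₁ := hmono j hj.le (i + 1) hij
  -- A repeated home would put a later vertex within `3 * r ≤ ρ - 1` of an earlier centre.
  have h₂ := hXlt j hj
  refine hout (X i) (X j) (by rw [← hX]; omega) (by rwa [← hX]) h₂.le ?_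
  have h₃ := S.near_home (γ (X j))
  have h₄ := S.lt_ρ (γ (X j))
  rw [← heq] at h₃ h₄
  exact h₃.mono (by omega)

end SimpleGraph

/-! ### From cluster systems to global emulators -/

namespace SimpleGraph

variable {V : Type*} {G : SimpleGraph V}

/-- A cluster system whose inner balls are disjoint, and such that heavy clusters of total error
at least `Q` have inner balls of total size at least `W`, extends to a set of pairs with
error `24 * Q`. -/
theorem ClusterSystem.exists_pairs [Fintype V] {F : Finset (V × V)} {Q : ℕ}
    (S : ClusterSystem G F Q) (W : ℕ)
    (hdisj : ∀ u v, S.home u ≠ S.home v →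
      Disjoint (G.nearSet (S.home u) (S.r (S.home u))) (G.nearSet (S.home v) (S.r (S.home v))))
    (hW : ∀ P : Finset V, (∀ c ∈ P, ¬ S.light c) → Q ≤ ∑ c ∈ P, S.f c →
      W ≤ ∑ c ∈ P, (G.nearSet c (S.r c)).card) :
    ∃ F' : Finset (V × V), F'.card * W ^ 2 ≤ F.card * W ^ 2 + Fintype.card V ^ 2 ∧
      ∀ s t, G.Reachable s t → G.Conn F' s t (G.dist s t + 24 * Q) := by
  classical
  refine exists_shortcuts F Q W fun s t L hL hmin => ?_
  obtain ⟨p, hp⟩ := hL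
  have hpL : p.length = L := le_antisymm hp (hmin _ ⟨p, le_rfl⟩)
  obtain ⟨k, X, e, hX0, hXk, hinc, hconn, heQ, hlight, hheavy, hinj⟩ := S.exists_jumps p
  rw [hpL] at hXk
  set γ := p.getVert with hγ
  have hγ0 : γ (X 0) = s := by rw [hX0]; exact p.getVert_zero
  have hγk : γ (X k) = t := by rw [hXk, ← hpL]; exact p.getVert_length
  have hchain : ∀ i j, i ≤ j → j ≤ k → X i ≤ X j ∧
      G.Conn F (γ (X i)) (γ (X j)) (X j - X i + ∑ l ∈ Finset.Ico i j, e l) := by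
    intro i j hij
    induction j, hij using Nat.le_induction with
    | base => exact fun _ => ⟨le_rfl, .refl _ _⟩
    | succ j hij ih =>
      intro hj
      obtain ⟨h₁, h₂⟩ := ih (by omega)
      have h₃ := hinc j hj
      refine ⟨h₁.trans h₃, (h₂.trans (hconn j hj)).mono ?_⟩
      rw [Finset.sum_Ico_succ_top hij]
      omega
  let c : ℕ → V := fun i => S.home (γ (X i))
  let heavy : Finset ℕ → Finset ℕ := fun J => J.filter fun i => ¬ S.light (c i)
  let block : Finset ℕ → Finset V := fun J => (heavy J).biUnion fun i => G.nearSet (c i) (S.r (c i))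
  have hinj' : ∀ i < k, ∀ j < k, i ≠ j → c i ≠ c j := by
    intro i hi j hj hij
    rcases lt_or_gt_of_ne hij with h | h
    · exact hinj j hj i h
    · exact (hinj i hi j h).symm
  have hblock : ∀ J ⊆ Finset.range k, 3 * Q ≤ ∑ i ∈ J, e i → W ≤ (block J).card := by
    intro J hJ hsum
    have hk : ∀ i ∈ heavy J, i < k := fun i hi =>
      Finset.mem_range.1 (hJ (Finset.mem_of_mem_filter i hi))
    have hsplit := Finset.sum_filter_add_sum_filter_not J (fun i => S.light (c i)) e
    -- Only the first and the last jump can err in a light cluster, so of an error of `3 * Q` at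
    -- least `Q` is heavy.
    have hl : ∑ i ∈ J.filter (fun i => S.light (c i)), e i ≤ 2 * Q := by
      rw [← Finset.sum_filter_ne_zero]
      set A := (J.filter fun i => S.light (c i)).filter fun i => e i ≠ 0
      have hA : ∀ i ∈ A, i < k ∧ i ∈ ({0, k - 1} : Finset ℕ) := by
        intro i hi
        simp only [A, Finset.mem_filter] at hi
        have hik := Finset.mem_range.1 (hJ hi.1.1)
        refine ⟨hik, ?_⟩
        simp only [Finset.mem_insert, Finset.mem_singleton]
        have := hlight i hik hi.1.2 hi.2
        omega
      refine (Finset.sum_le_card_nsmul A e Q fun i hi => heQ i (hA i hi).1).trans ?_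
      rw [smul_eq_mul]
      exact Nat.mul_le_mul_right _
        ((Finset.card_le_card fun i hi => (hA i hi).2).trans Finset.card_le_two)
    have hinjOn : Set.InjOn c (heavy J) := by
      intro i hi j hj hij
      by_contra h
      exact hinj' i (hk i hi) j (hk j hj) h hij
    have hf : Q ≤ ∑ v ∈ (heavy J).image c, S.f v := by
      rw [Finset.sum_image hinjOn]
      have : ∑ i ∈ heavy J, e i ≤ ∑ i ∈ heavy J, S.f (c i) :=
        Finset.sum_le_sum fun i hi => hheavy i (hk i hi) (Finset.mem_filter.1 hi).2
      change _ + ∑ i ∈ heavy J, e i = _ at hsplit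
      omega
    refine (hW _ ?_ hf).trans ?_
    · intro v hv
      obtain ⟨i, hi, rfl⟩ := Finset.mem_image.1 hv
      exact (Finset.mem_filter.1 hi).2
    · rw [Finset.sum_image hinjOn, Finset.card_biUnion]
      intro i hi j hj hij
      exact hdisj _ _ (hinj' i (hk i hi) j (hk j hj) hij)
  have hball : ∀ i x, x ∈ G.nearSet (c i) (S.r (c i)) → G.Conn F (γ (X i)) x Q := by
    intro i x hx
    have h₁ := S.near_home (γ (X i))
    have h₂ : G.Near (S.home (γ (X i))) x (S.r (S.home (γ (X i)))) := mem_nearSet.1 hx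
    have h₃ := (Conn.edge (S.star _ _ (h₁.mono (by omega))) h₁).symm.trans
      (.edge (S.star _ _ (h₂.mono (by omega))) h₂)
    have := S.le_Q (γ (X i))
    exact h₃.mono (by omega)
  by_cases htot : ∑ l ∈ Finset.Ico 0 k, e l < 7 * Q
  · left
    have := (hchain 0 k (Nat.zero_le _) le_rfl).2
    rw [hγ0, hγk, hX0, hXk] at this
    exact this.mono (by omega)
  push Not at htot
  have hsplit : ∀ i j, i ≤ j → ∀ l, j ≤ l →
      ∑ x ∈ Finset.Ico i j, e x + ∑ x ∈ Finset.Ico j l, e x = ∑ x ∈ Finset.Ico i l, e x :=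
    fun i j hij l hjl => Finset.sum_Ico_consecutive e hij hjl
  -- Shortest prefix and suffix of error at least `3 * Q`; single errors of at most `Q` keep both
  -- below `4 * Q`. If they overlap, the total error is at most `8 * Q` and no shortcut is needed.
  have hex : ∃ a, 3 * Q ≤ ∑ x ∈ Finset.Ico 0 a, e x := ⟨k, by omega⟩
  obtain ⟨a, ha, ha', hak⟩ : ∃ a, 3 * Q ≤ ∑ x ∈ Finset.Ico 0 a, e x ∧
      ∑ x ∈ Finset.Ico 0 a, e x ≤ 4 * Q ∧ a ≤ k := by
    have hak : Nat.find hex ≤ k := Nat.find_min' hex (by omega)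
    refine ⟨Nat.find hex, Nat.find_spec hex, ?_, hak⟩
    rcases Nat.eq_zero_or_pos (Nat.find hex) with h | h
    · rw [h, Finset.Ico_self, Finset.sum_empty]
      exact Nat.zero_le _
    · have h₁ := Nat.find_min hex (Nat.sub_lt h one_pos)
      have h₂ := heQ (Nat.find hex - 1) (by omega)
      have h₃ := Finset.sum_Ico_succ_top (Nat.zero_le (Nat.find hex - 1)) e
      rw [Nat.sub_add_cancel h] at h₃
      omega
  obtain ⟨b, hb, hb', hbk⟩ : ∃ b, 3 * Q ≤ ∑ x ∈ Finset.Ico b k, e x ∧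
      ∑ x ∈ Finset.Ico b k, e x ≤ 4 * Q ∧ b ≤ k := by
    let P : ℕ → Prop := fun b => 3 * Q ≤ ∑ x ∈ Finset.Ico b k, e x
    have hP : P (Nat.findGreatest P k) :=
      Nat.findGreatest_spec (P := P) (Nat.zero_le k) (by simp only [P]; omega)
    have hbk : Nat.findGreatest P k ≤ k := Nat.findGreatest_le k
    refine ⟨Nat.findGreatest P k, hP, ?_, hbk⟩
    rcases hbk.eq_or_lt with h | h
    · simp [h]
    · have h₁ : ¬ P _ := Nat.findGreatest_is_greatest (lt_add_one _) h
      have h₂ := heQ _ h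
      have h₃ := Finset.sum_eq_sum_Ico_succ_bot h e
      simp only [P] at h₁ h₂ h₃ ⊢
      omega
  have hab : a ≤ b ∨ G.Conn F s t (L + 24 * Q) := by
    rcases le_total a b with hab | hab
    · exact .inl hab
    · right
      have h₁ := hsplit 0 b (Nat.zero_le _) a hab
      have h₂ := hsplit 0 b (Nat.zero_le _) k hbk
      have := (hchain 0 k (Nat.zero_le _) le_rfl).2
      rw [hγ0, hγk, hX0, hXk] at this
      exact this.mono (by omega)
  refine hab.symm.imp id fun hab => ?_
  have hIco : ∀ i j, j ≤ k → Finset.Ico i j ⊆ Finset.range k := by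
    intro i j hj x hx
    have := Finset.mem_Ico.1 hx
    exact Finset.mem_range.2 (by omega)
  refine ⟨γ (X a), γ (X b), block (Finset.Ico 0 a), block (Finset.Ico b k), X b - X a,
    p.near_getVert (hchain a b hab hbk).1, hblock _ (hIco _ _ hak) ha,
    hblock _ (hIco _ _ le_rfl) hb, ?_⟩
  intro x hx y hy
  obtain ⟨i, hi, hxi⟩ := Finset.mem_biUnion.1 hx
  obtain ⟨j, hj, hyj⟩ := Finset.mem_biUnion.1 hy
  have hi' := Finset.mem_Ico.1 (Finset.mem_of_mem_filter i hi)
  have hj' := Finset.mem_Ico.1 (Finset.mem_of_mem_filter j hj)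
  obtain ⟨m₁, c₁⟩ := hchain 0 i (Nat.zero_le _) (by omega)
  obtain ⟨m₂, c₂⟩ := hchain i a (by omega) (by omega)
  obtain ⟨m₃, -⟩ := hchain a b hab hbk
  obtain ⟨m₄, c₄⟩ := hchain b j (by omega) (by omega)
  obtain ⟨m₅, c₅⟩ := hchain j k (by omega) le_rfl
  have s₁ := hsplit 0 i (Nat.zero_le _) a (by omega)
  have s₂ := hsplit b j (by omega) k (by omega)
  have n₁ := p.near_getVert m₁
  have n₂ := p.near_getVert m₂
  have n₄ := p.near_getVert m₄
  have n₅ := p.near_getVert m₅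
  rw [← hγ] at n₁ n₂ n₄ n₅
  rw [hγ0] at c₁ n₁
  rw [hγk] at c₅ n₅
  exact ⟨γ (X i), γ (X j), X i - X 0, X a - X i, X j - X b, X k - X j, by omega, n₁, n₂, n₄, n₅,
    c₁.mono (by omega), c₂.mono (by omega), hball i x hxi, c₄.mono (by omega),
    c₅.mono (by omega), hball j y hyj⟩

end SimpleGraph

/-! ### Covering, thin spheres and local emulators -/

namespace SimpleGraph

variable {V : Type*} {G : SimpleGraph V}

theorem nearSet_mono [Fintype V] {c : V} {a b : ℕ} (h : a ≤ b) : G.nearSet c a ⊆ G.nearSet c b :=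
  fun _ hv => mem_nearSet.2 ((mem_nearSet.1 hv).mono h)

/-- Otherwise the ball would grow by more than a factor `K` at each of `log_K |V| + 1` scales and
outgrow `V`. -/
theorem exists_slow_growth [Fintype V] (G : SimpleGraph V) (v : V) (R : ℕ) {b K : ℕ}
    (hK : 1 < K) :
    ∃ j ≤ Nat.log K (Fintype.card V),
      (G.nearSet v (b * (R * b ^ j))).card ≤ K * (G.nearSet v (R * b ^ j)).card := by
  by_contra! h
  have hgrow : ∀ j ≤ Nat.log K (Fintype.card V) + 1, K ^ j ≤ (G.nearSet v (R * b ^ j)).card := by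
    intro j
    induction j with
    | zero =>
      intro _
      exact Finset.card_pos.2 ⟨v, mem_nearSet.2 (.refl _ _)⟩
    | succ j ih =>
      intro hj
      have h₁ := h j (by omega)
      have h₂ := Nat.mul_le_mul_left K (ih (by omega))
      rw [show R * b ^ (j + 1) = b * (R * b ^ j) by ring, pow_succ']
      omega
  have h₁ := hgrow _ le_rfl
  have h₂ := Nat.lt_pow_succ_log_self hK (Fintype.card V)
  have h₃ := Finset.card_le_univ
    (G.nearSet v (R * b ^ (Nat.log K (Fintype.card V) + 1)))
  rw [Nat.succ_eq_add_one] at h₂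
  omega

/-- Covering by balls around disjoint cores whose enlargements have total size `O(|V|)`. -/
theorem exists_cover [Fintype V] (G : SimpleGraph V) (R : ℕ) {K : ℕ} (hK : 1 < K) :
    ∃ (home : V → V) (r : V → ℕ),
      (∀ v, R ≤ r v ∧ r v ≤ R * 8 ^ Nat.log K (Fintype.card V)) ∧
      (∀ v, (G.nearSet v (8 * r v)).card ≤ K * (G.nearSet v (r v)).card) ∧
      (∀ u, G.Near (home u) u (3 * r (home u))) ∧
      ∀ u v, home u ≠ home v →
        Disjoint (G.nearSet (home u) (r (home u))) (G.nearSet (home v) (r (home v))) := by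
  choose j hj hcard using fun v => G.exists_slow_growth v R (b := 8) hK
  let r : V → ℕ := fun v => R * 8 ^ j v
  -- With factor `2`, the ball at `u` meets a selected ball of radius at least half its own, so `u`
  -- is within `2r + r = 3r` of that centre.
  obtain ⟨I, -, hdisj, hcov⟩ := Vitali.exists_disjoint_subfamily_covering_enlargement
    (fun v => (G.nearSet v (r v) : Set V)) Set.univ (fun v => (r v : ℝ)) 2 one_lt_two
    (fun _ _ => Nat.cast_nonneg _) ((R * 8 ^ Nat.log K (Fintype.card V) : ℕ) : ℝ)
    (fun v _ => Nat.cast_le.2 (Nat.mul_le_mul_left _ (Nat.pow_le_pow_right (by norm_num) (hj v))))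
    (fun v _ => ⟨v, mem_nearSet.2 (.refl _ _)⟩)
  choose! home hI hinter hr using fun u => hcov u (Set.mem_univ u)
  refine ⟨home, r, fun v => ⟨Nat.le_mul_of_pos_right _ (by positivity),
    Nat.mul_le_mul_left _ (Nat.pow_le_pow_right (by norm_num) (hj v))⟩, hcard, ?_, ?_⟩
  · intro u
    obtain ⟨x, hx₁, hx₂⟩ := hinter u
    have h₁ := mem_nearSet.1 hx₁
    have h₂ := mem_nearSet.1 hx₂
    have h₃ : r u ≤ 2 * r (home u) := by exact_mod_cast hr u
    exact (h₂.trans h₁.symm).mono (by omega)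
  · intro u v huv
    exact Finset.disjoint_coe.1 (hdisj (hI u) (hI v) huv)

/-- The vertices at distance exactly `r` from `c`. -/
noncomputable def sphereSet [Fintype V] (G : SimpleGraph V) (c : V) (r : ℕ) : Finset V :=
  open Classical in G.nearSet c r \ G.nearSet c (r - 1)

theorem mem_sphereSet [Fintype V] {c v : V} {r : ℕ} :
    v ∈ G.sphereSet c r ↔ G.Near c v r ∧ ¬ G.Near c v (r - 1) := by
  simp [sphereSet, mem_nearSet]

/-- The `r` spheres of radii in `(3r, 4r]` are disjoint subsets of the ball of radius `8r`; the
smallest is at most the average. -/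
theorem exists_small_sphere [Fintype V] (G : SimpleGraph V) (c : V) {r : ℕ} (hr : 0 < r) :
    ∃ ρ, 3 * r < ρ ∧ ρ ≤ 4 * r ∧
      (G.sphereSet c ρ).card * r ≤ (G.nearSet c (8 * r)).card := by
  classical
  have hsum : ∀ m, ∑ i ∈ Finset.range m, (G.sphereSet c (3 * r + 1 + i)).card
      + (G.nearSet c (3 * r)).card = (G.nearSet c (3 * r + m)).card := by
    intro m
    induction m with
    | zero => simp
    | succ m ih =>
      have h₁ := Finset.card_sdiff_add_card_eq_card
        (nearSet_mono (G := G) (c := c) (Nat.le_succ (3 * r + m)))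
      have h₂ : (G.sphereSet c (3 * r + 1 + m)).card
          = (G.nearSet c (3 * r + m).succ \ G.nearSet c (3 * r + m)).card := by
        unfold sphereSet
        rw [show 3 * r + 1 + m = (3 * r + m).succ by omega, Nat.succ_sub_one]
      rw [Finset.sum_range_succ, show 3 * r + (m + 1) = (3 * r + m).succ by omega]
      omega
  have hle : ∑ i ∈ Finset.range r, (G.sphereSet c (3 * r + 1 + i)).card * r
      ≤ ∑ _i ∈ Finset.range r, (G.nearSet c (8 * r)).card := by
    rw [← Finset.sum_mul, Finset.sum_const, Finset.card_range, smul_eq_mul, mul_comm]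
    refine Nat.mul_le_mul_left _ ?_
    have h₁ := hsum r
    have h₂ := Finset.card_le_card
      (nearSet_mono (G := G) (c := c) (show 3 * r + r ≤ 8 * r by omega))
    omega
  obtain ⟨i, hi, h⟩ := Finset.exists_le_of_sum_le ⟨0, Finset.mem_range.2 hr⟩ hle
  have := Finset.mem_range.1 hi
  exact ⟨3 * r + 1 + i, by omega, by omega, h⟩

/-- An emulator of the subgraph induced on the ball of radius `8 * r` serves all pairs of
vertices of the ball of radius `4 * r`. -/
theorem conn_of_induce [Fintype V] [DecidableEq V] {c u w : V} {r d e : ℕ}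
    {F : Finset ((G.nearSet c (8 * r) : Set V) × (G.nearSet c (8 * r) : Set V))}
    (hF : ∀ s t, (G.induce (G.nearSet c (8 * r) : Set V)).Reachable s t →
      (G.induce (G.nearSet c (8 * r) : Set V)).Conn F s t
        ((G.induce (G.nearSet c (8 * r) : Set V)).dist s t + e))
    (hu : G.Near c u (4 * r)) (hw : G.Near c w (4 * r)) (h : G.Near u w d) :
    G.Conn (F.image (Prod.map Subtype.val Subtype.val)) u w (d + e) := by
  obtain ⟨p, hp⟩ := h.reachable.exists_walk_length_eq_dist
  have h₁ := (hu.symm.trans hw).dist_le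
  have hsupp : ∀ x ∈ p.support, x ∈ (G.nearSet c (8 * r) : Set V) := by
    intro x hx
    obtain ⟨i, rfl, hi⟩ := Walk.mem_support_iff_exists_getVert.1 hx
    have h₂ := p.near_getVert (Nat.zero_le i)
    have h₃ := p.near_getVert hi
    rw [p.getVert_zero] at h₂
    rw [p.getVert_length] at h₃
    refine mem_nearSet.2 ?_
    rcases le_total i (4 * r) with h | h
    · exact (hu.trans h₂).mono (by omega)
    · exact (hw.trans h₃.symm).mono (by omega)
  let p' := p.induce _ hsupp
  have hlen : p'.length = p.length := by
    have := congrArg Walk.length (p.map_induce hsupp)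
    rwa [Walk.length_map] at this
  have h₂ := (hF _ _ ⟨p'⟩).map (Embedding.induce _).toHom
  refine h₂.mono ?_
  have h₃ := dist_le p'
  have h₄ := h.dist_le
  omega

/-- Stars, boundary edges and local emulators cost `1`, `1` and `E` times the total cluster size,
which is at most `K * |V|` by slow growth and disjoint cores. The hypothesis `hx` has the factor `K`
because the blocks hit by shortcuts consist of cores. -/
theorem exists_pairs_of_induce [Fintype V] (G : SimpleGraph V) {R K E : ℕ} {x : ℝ} {g : ℕ → ℕ}
    (hR : 0 < R) (hK : 1 < K)
    (hE : ∀ D : Finset V, ∃ F : Finset (↥(D : Set V) × ↥(D : Set V)), F.card ≤ E * D.card ∧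
      ∀ s t, (G.induce (D : Set V)).Reachable s t →
        (G.induce (D : Set V)).Conn F s t ((G.induce (D : Set V)).dist s t + g D.card))
    (hx : ∀ (P : Finset V) (m : V → ℕ), (∀ c ∈ P, R ^ 2 < m c) → R ≤ ∑ c ∈ P, g (m c) →
      x * K ≤ ∑ c ∈ P, m c) :
    ∃ F : Finset (V × V),
      F.card * ⌈x⌉₊ ^ 2 ≤ (E + 2) * (K * Fintype.card V) * ⌈x⌉₊ ^ 2 + Fintype.card V ^ 2 ∧
      ∀ s t, G.Reachable s t →
        G.Conn F s t (G.dist s t + 24 * (7 * (R * 8 ^ Nat.log K (Fintype.card V)))) := by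
  classical
  obtain ⟨home, r, hr, hgrow, hhome, hdisj⟩ := G.exists_cover R hK
  have hrpos : ∀ v, 0 < r v := fun v => hR.trans_le (hr v).1
  choose ρ hρ₁ hρ₂ hρ₃ using fun v => G.exists_small_sphere v (hrpos v)
  choose Fe hFe₁ hFe₂ using fun v => hE (G.nearSet v (8 * r v))
  let D : V → Finset V := fun v => G.nearSet v (8 * r v)
  let L : V → Finset V := fun v => G.sphereSet v (ρ v)
  let light : V → Prop := fun v => (D v).card ≤ R ^ 2
  let I : Finset V := Finset.univ.image home
  have hI : ∀ u, home u ∈ I := fun u => Finset.mem_image_of_mem _ (Finset.mem_univ u)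
  let F₁ : Finset (V × V) := I.biUnion fun c => {c} ×ˢ D c
  let F₂ : Finset (V × V) := I.biUnion fun c =>
    ((L c).filter fun u => light (home u)).biUnion fun u => {u} ×ˢ L (home u)
  let F₃ : Finset (V × V) := I.biUnion fun c =>
    (Fe c).image (Prod.map Subtype.val Subtype.val)
  have hLlight : ∀ v, light v → (L v).card ≤ R := by
    intro v hv
    have h₁ : (L v).card * r v ≤ (D v).card := hρ₃ v
    have h₂ : (L v).card * R ≤ R * R := by
      rw [← sq]
      exact ((Nat.mul_le_mul_left _ (hr v).1).trans h₁).trans hv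
    exact Nat.le_of_mul_le_mul_right h₂ hR
  have hDsum : ∑ c ∈ I, (D c).card ≤ K * Fintype.card V := by
    refine (Finset.sum_le_sum fun c _ => hgrow c).trans ?_
    rw [← Finset.mul_sum, ← Finset.card_biUnion]
    · exact Nat.mul_le_mul_left _ (Finset.card_le_univ _)
    · intro a ha b hb hab
      obtain ⟨a, -, rfl⟩ := Finset.mem_image.1 ha
      obtain ⟨b, -, rfl⟩ := Finset.mem_image.1 hb
      exact hdisj a b hab
  have hF₁ : F₁.card ≤ ∑ c ∈ I, (D c).card := by
    refine Finset.card_biUnion_le.trans (Finset.sum_le_sum fun c _ => ?_)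
    simp
  -- Each boundary vertex of `c` sends at most `R ≤ r c` edges, and the sphere was chosen with at
  -- most `|D c| / r c` vertices.
  have hF₂ : F₂.card ≤ ∑ c ∈ I, (D c).card := by
    refine Finset.card_biUnion_le.trans (Finset.sum_le_sum fun c _ => ?_)
    refine (Finset.card_biUnion_le_card_mul _ _ R fun u hu => ?_).trans ?_
    · rw [Finset.card_product, Finset.card_singleton, one_mul]
      exact hLlight _ (Finset.mem_filter.1 hu).2
    · refine (Nat.mul_le_mul ?_ (hr c).1).trans (hρ₃ c)
      exact Finset.card_filter_le _ _
  have hF₃ : F₃.card ≤ E * ∑ c ∈ I, (D c).card := by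
    rw [Finset.mul_sum]
    refine Finset.card_biUnion_le.trans (Finset.sum_le_sum fun c _ => ?_)
    exact Finset.card_image_le.trans (hFe₁ c)
  have hsub₁ : F₁ ⊆ F₁ ∪ F₂ ∪ F₃ := fun _ h =>
    Finset.mem_union_left _ (Finset.mem_union_left _ h)
  have hsub₂ : F₂ ⊆ F₁ ∪ F₂ ∪ F₃ := fun _ h =>
    Finset.mem_union_left _ (Finset.mem_union_right _ h)
  have hcard : (F₁ ∪ F₂ ∪ F₃).card ≤ (E + 2) * (K * Fintype.card V) := by
    refine (Finset.card_union_le _ _).trans ((Nat.add_le_add_right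
      (Finset.card_union_le _ _) _).trans ?_)
    refine le_trans ?_ (Nat.mul_le_mul_left (E + 2) hDsum)
    rw [add_mul]
    omega
  let S : ClusterSystem G (F₁ ∪ F₂ ∪ F₃) (7 * (R * 8 ^ Nat.log K (Fintype.card V))) :=
    { home := home
      r := r
      ρ := ρ
      f := fun c => g (D c).card
      light := light
      near_home := hhome
      lt_ρ := fun u => hρ₁ _
      ρ_le := fun u => hρ₂ _
      le_Q := fun u => Nat.mul_le_mul_left _ (hr _).2
      star := fun u y hy => hsub₁ <| Finset.mem_biUnion.2 ⟨home u, hI u,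
        Finset.mem_product.2 ⟨Finset.mem_singleton_self _, mem_nearSet.2 (hy.mono (by omega))⟩⟩
      cross := fun v u w hl h₁ h₂ h₃ h₄ => hsub₂ <| Finset.mem_biUnion.2 ⟨home v, hI v,
        Finset.mem_biUnion.2 ⟨u, Finset.mem_filter.2 ⟨mem_sphereSet.2 ⟨h₁, h₂⟩, hl⟩,
          Finset.mem_product.2 ⟨Finset.mem_singleton_self _, mem_sphereSet.2 ⟨h₃, h₄⟩⟩⟩⟩
      emulate := fun u w d _ hw huw =>
        (conn_of_induce (hFe₂ (home u)) ((hhome u).mono (by omega)) hw huw).subset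
          ((Finset.subset_biUnion_of_mem (fun c => (Fe c).image
            (Prod.map Subtype.val Subtype.val)) (hI u)).trans Finset.subset_union_right) }
  obtain ⟨F, hF, hconn⟩ := S.exists_pairs ⌈x⌉₊ hdisj (by
    intro P hP hQ
    have h₁ := hx P (fun c => (D c).card) (fun c hc => not_le.1 (hP c hc))
      (le_trans (by nlinarith [Nat.one_le_pow (Nat.log K (Fintype.card V)) 8 (by norm_num)]) hQ)
    have h₂ : ∑ c ∈ P, (D c).card ≤ K * ∑ c ∈ P, (G.nearSet c (r c)).card := by
      rw [Finset.mul_sum]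
      exact Finset.sum_le_sum fun c _ => hgrow c
    have h₃ : x * K ≤ ((∑ c ∈ P, (G.nearSet c (r c)).card : ℕ) : ℝ) * K := by
      refine h₁.trans ?_
      rw [mul_comm _ (K : ℝ)]
      exact_mod_cast h₂
    exact Nat.ceil_le.2 (le_of_mul_le_mul_right h₃ (by positivity)))
  exact ⟨F, hF.trans (Nat.add_le_add_right (Nat.mul_le_mul_right _ hcard) _), hconn⟩

end SimpleGraph

/-! ### Exponents and the main theorem -/

namespace SimpleGraph

/-- As `m > R²` and `a ≤ 1`, `m^a ≤ m * R^(-2(1-a))`: heavy clusters have small error per vertex. -/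
theorem sum_lower_bound {V : Type*} {R : ℕ} {C a : ℝ} (hC : 0 < C) (ha : a ≤ 1) (P : Finset V)
    (m : V → ℕ) (hm : ∀ c ∈ P, R ^ 2 < m c) (hR : 0 < R)
    (h : R ≤ ∑ c ∈ P, ⌊C * (m c : ℝ) ^ a⌋₊) :
    (R : ℝ) ^ (3 - 2 * a) / C ≤ ∑ c ∈ P, (m c : ℝ) := by
  have hR' : (0 : ℝ) < R := by exact_mod_cast hR
  have h₁ : (R : ℝ) ≤ ∑ c ∈ P, C * (m c : ℝ) ^ a := by
    have h₂ : (R : ℝ) ≤ ((∑ c ∈ P, ⌊C * (m c : ℝ) ^ a⌋₊ : ℕ) : ℝ) := by exact_mod_cast h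
    rw [Nat.cast_sum] at h₂
    exact h₂.trans (Finset.sum_le_sum fun c _ => Nat.floor_le (by positivity))
  rw [← Finset.mul_sum] at h₁
  have h₂ : (R : ℝ) ^ (2 - 2 * a) * ∑ c ∈ P, (m c : ℝ) ^ a ≤ ∑ c ∈ P, (m c : ℝ) := by
    rw [Finset.mul_sum]
    refine Finset.sum_le_sum fun c hc => ?_
    have h₃ : (R : ℝ) ^ 2 ≤ m c := by exact_mod_cast (hm c hc).le
    have h₄ : (0 : ℝ) < m c := lt_of_lt_of_le (by positivity) h₃
    have h₅ : (R : ℝ) ^ (2 - 2 * a) ≤ (m c : ℝ) ^ (1 - a) := by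
      rw [show 2 - 2 * a = 2 * (1 - a) by ring, Real.rpow_mul hR'.le, Real.rpow_two]
      exact Real.rpow_le_rpow (by positivity) h₃ (by linarith)
    calc (R : ℝ) ^ (2 - 2 * a) * (m c : ℝ) ^ a ≤ (m c : ℝ) ^ (1 - a) * (m c : ℝ) ^ a := by gcongr
      _ = m c := by rw [← Real.rpow_add h₄]; simp
  refine le_trans ?_ h₂
  rw [show 3 - 2 * a = (2 - 2 * a) + 1 by ring, Real.rpow_add hR', Real.rpow_one,
    mul_div_assoc]
  gcongr
  rw [div_le_iff₀' hC]
  exact h₁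

/-- Bounds the spread of cluster radii by an arbitrarily small power of `n`, at the price of the
constant growth factor `8 ^ q`. -/
theorem eight_pow_log_le {n q : ℕ} (hn : n ≠ 0) (hq : q ≠ 0) :
    (8 : ℝ) ^ Nat.log (8 ^ q) n ≤ (n : ℝ) ^ ((q : ℝ)⁻¹) := by
  rw [Real.le_rpow_inv_iff_of_pos (by positivity) (by positivity) (by positivity),
    Real.rpow_natCast, ← pow_mul, mul_comm, pow_mul]
  exact_mod_cast Nat.pow_log_le_self _ hn

end SimpleGraph

open SimpleGraph in
theorem HasLinearSizeEmulators.exists_pairs_induce {C K : ℝ≥0} {a : ℝ}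
    (h : ∀ (V : Type u) [Fintype V] (G : SimpleGraph V), ∃ H : WeightedGraph V,
      (H.numEdges : ℝ≥0) ≤ K * (Fintype.card V : ℝ≥0) ∧
      H.IsAdditiveEmulator G (C * (Fintype.card V : ℝ≥0) ^ a))
    {V : Type u} (G : SimpleGraph V) (D : Finset V) :
    ∃ F : Finset (↥(D : Set V) × ↥(D : Set V)), F.card ≤ ⌈K⌉₊ * D.card ∧
      ∀ s t, (G.induce (D : Set V)).Reachable s t → (G.induce (D : Set V)).Conn F s t
        ((G.induce (D : Set V)).dist s t + ⌊((C + 1 : ℝ≥0) : ℝ) * (D.card : ℝ) ^ a⌋₊) := by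
  obtain ⟨H, hH₁, hH₂⟩ := h (D : Set V) (G.induce (D : Set V))
  obtain ⟨F, hF₁, hF₂⟩ := WeightedGraph.exists_pairs_of_isAdditiveEmulator hH₂
  have hcard : Fintype.card (D : Set V) = D.card := by simp
  rw [hcard] at hH₁ hF₂
  refine ⟨F, ?_, fun s t hst => (hF₂ s t hst).mono (Nat.add_le_add_left ?_ _)⟩
  · have h₁ : (F.card : ℝ≥0) ≤ ⌈K⌉₊ * D.card :=
      (Nat.cast_le.2 hF₁).trans (hH₁.trans (mul_le_mul_left (Nat.le_ceil K) _))
    exact_mod_cast h₁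
  · refine Nat.le_floor ?_
    have h₁ := Nat.floor_le (show (0 : ℝ≥0) ≤ C * (D.card : ℝ≥0) ^ a from zero_le)
    have h₂ : ((⌊C * (D.card : ℝ≥0) ^ a⌋₊ : ℝ≥0) : ℝ) ≤ ((C * (D.card : ℝ≥0) ^ a : ℝ≥0) : ℝ) :=
      NNReal.coe_le_coe.2 h₁
    push_cast at h₂ ⊢
    refine h₂.trans ?_
    gcongr
    simp

theorem mainTheorem2 (α : ℝ) (hα : α ∈ Set.Ioo (0 : ℝ) 1)
    (h : HasLinearSizeEmulators.{u} α) :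
    HasLinearSizeEmulators.{u} (1 / (6 - 4 * α)) := by
  obtain ⟨hα₀, hα₁⟩ := hα
  obtain ⟨C, hC⟩ := h
  -- `336 = 24 * 7 * 2`, the `2` from rounding `n^b` up to `R`.
  refine ⟨336, fun ε hε => ?_⟩
  set β : ℝ := 1 / (6 - 4 * α) with hβ
  have hβpos : 0 < β := by rw [hβ]; exact one_div_pos.2 (by linarith)
  have hβmul : β * (6 - 4 * α) = 1 := one_div_mul_cancel (by linarith)
  set b : ℝ := β + ε / 2 with hb
  have hbpos : 0 < b := by positivity
  -- Half of `ε` goes into `b`, half into the spread of radii. The loss `2 * b * δ ≤ ε / 2` in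
  -- `hexp` is absorbed by the gain `(ε / 2) * (3 - 2 * α)`, as `3 - 2 * α ≥ 1`.
  set δ : ℝ := min (1 - α) (ε / (4 * b)) with hδ
  have hδpos : 0 < δ := lt_min (by linarith) (by positivity)
  have hδ₁ : α + δ ≤ 1 := by linarith [min_le_left (1 - α) (ε / (4 * b))]
  have hδ₂ : δ * (4 * b) ≤ ε := by
    rw [← le_div_iff₀ (by positivity)]
    exact min_le_right _ _
  have hexp : 1 / 2 ≤ b * (3 - 2 * (α + δ)) := by
    rw [hb] at hδ₂ ⊢
    nlinarith
  obtain ⟨E, hE⟩ := hC δ hδpos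
  set q : ℕ := ⌈2 / ε⌉₊ with hq
  have hqpos : 0 < q := Nat.ceil_pos.2 (by positivity)
  have hqε : (q : ℝ)⁻¹ ≤ ε / 2 := by
    rw [inv_le_comm₀ (by positivity) (by positivity), inv_div]
    exact Nat.le_ceil _
  set K : ℕ := 8 ^ q with hK
  have hK1 : 1 < K := Nat.one_lt_pow hqpos.ne' (by norm_num)
  refine ⟨(⌈E⌉₊ + 2) * K + ((C + 1) * K) ^ 2, fun V _ G => ?_⟩
  rcases isEmpty_or_nonempty V with hV | hV
  · exact ⟨.ofPairs G ∅, by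
      simpa using WeightedGraph.numEdges_ofPairs_le (G := G) ∅, fun s => hV.elim s⟩
  set n : ℕ := Fintype.card V with hn
  have hn1 : 1 ≤ n := Fintype.card_pos
  have hn1' : (1 : ℝ) ≤ n := by exact_mod_cast hn1
  have hnb : (1 : ℝ) ≤ (n : ℝ) ^ b := Real.one_le_rpow hn1' hbpos.le
  set R : ℕ := ⌈(n : ℝ) ^ b⌉₊ with hR
  have hRpos : 0 < R := Nat.ceil_pos.2 (by positivity)
  have hRge : (n : ℝ) ^ b ≤ R := Nat.le_ceil _
  have hRle : (R : ℝ) ≤ 2 * (n : ℝ) ^ b := by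
    linarith [Nat.ceil_lt_add_one (show 0 ≤ (n : ℝ) ^ b by positivity)]
  have hC1 : (0 : ℝ) < ((C + 1 : ℝ≥0) : ℝ) := by positivity
  have hKpos : (0 : ℝ) < K := by positivity
  -- The block size, chosen so that `n² / x²` is a constant times `n`; `C + 1` avoids division by
  -- zero.
  set x : ℝ := Real.sqrt n / ((C + 1 : ℝ≥0) * K) with hx
  have hxpos : 0 < x := by positivity
  obtain ⟨F, hF₁, hF₂⟩ := G.exists_pairs_of_induce (x := x)
    (g := fun m => ⌊((C + 1 : ℝ≥0) : ℝ) * (m : ℝ) ^ (α + δ)⌋₊) hRpos hK1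
    (HasLinearSizeEmulators.exists_pairs_induce hE G) (by
      intro P m hm hsum
      have h₁ := SimpleGraph.sum_lower_bound hC1 hδ₁ P m hm hRpos hsum
      have h₂ : Real.sqrt n ≤ (R : ℝ) ^ (3 - 2 * (α + δ)) := by
        rw [Real.sqrt_eq_rpow]
        calc (n : ℝ) ^ (1 / 2 : ℝ) ≤ (n : ℝ) ^ (b * (3 - 2 * (α + δ))) :=
              Real.rpow_le_rpow_of_exponent_le hn1' hexp
          _ = ((n : ℝ) ^ b) ^ (3 - 2 * (α + δ)) := Real.rpow_mul (by positivity) _ _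
          _ ≤ _ := Real.rpow_le_rpow (by positivity) hRge (by linarith)
      have h₃ : x * K = Real.sqrt n / (C + 1 : ℝ≥0) := by
        rw [hx]
        field_simp
      rw [h₃, Nat.cast_sum]
      exact (div_le_div_of_nonneg_right h₂ hC1.le).trans h₁)
  refine ⟨.ofPairs G F, ?_, WeightedGraph.isAdditiveEmulator_ofPairs ?_ hF₂⟩
  · have hWx : x ≤ ⌈x⌉₊ := Nat.le_ceil x
    have hx2 : (n : ℝ) = x ^ 2 * ((C + 1 : ℝ≥0) * K) ^ 2 := by
      rw [hx, div_pow, Real.sq_sqrt (by positivity)]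
      field_simp
    have h₁ : (F.card : ℝ) * (⌈x⌉₊ : ℝ) ^ 2
        ≤ (⌈E⌉₊ + 2) * (K * n) * (⌈x⌉₊ : ℝ) ^ 2 + (n : ℝ) ^ 2 := by exact_mod_cast hF₁
    have h₂ : (n : ℝ) ^ 2 ≤ ((C + 1 : ℝ≥0) * K) ^ 2 * n * (⌈x⌉₊ : ℝ) ^ 2 := by
      calc (n : ℝ) ^ 2 = ((C + 1 : ℝ≥0) * K) ^ 2 * n * x ^ 2 := by rw [sq]; nth_rw 1 [hx2]; ring
        _ ≤ _ := by gcongr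
    have hW : (0 : ℝ) < (⌈x⌉₊ : ℝ) ^ 2 := by
      have := hxpos.trans_le hWx
      positivity
    have h₃ : (F.card : ℝ) ≤ (⌈E⌉₊ + 2) * (K * n) + ((C + 1 : ℝ≥0) * K) ^ 2 * n := by
      refine le_of_mul_le_mul_right ?_ hW
      linarith
    have h₄ : ((WeightedGraph.ofPairs G F).numEdges : ℝ) ≤ F.card := by
      exact_mod_cast WeightedGraph.numEdges_ofPairs_le F
    rw [← NNReal.coe_le_coe]
    push_cast at h₃ ⊢
    linarith
  · rw [← NNReal.coe_le_coe]
    push_cast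
    have h₁ : (8 : ℝ) ^ Nat.log K n ≤ (n : ℝ) ^ (ε / 2) :=
      (SimpleGraph.eight_pow_log_le (by omega) hqpos.ne').trans
        (Real.rpow_le_rpow_of_exponent_le hn1' hqε)
    have h₂ : (n : ℝ) ^ (β + ε) = (n : ℝ) ^ b * (n : ℝ) ^ (ε / 2) := by
      rw [← Real.rpow_add (by positivity), hb]
      ring_nf
    rw [h₂]
    calc (24 : ℝ) * (7 * (R * 8 ^ Nat.log K n))
        ≤ 24 * (7 * ((2 * (n : ℝ) ^ b) * (n : ℝ) ^ (ε / 2))) := by gcongr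
      _ = 336 * ((n : ℝ) ^ b * (n : ℝ) ^ (ε / 2)) := by ring
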